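/- Let $n\ge 1$. A permutation $\pi=\pi_1\cdots\pi_{2n}$ of the multiset $\{1,1,2,2,\dots,n,n\}$ is \emph{nonnesting} if it avoids the patterns $1221$ and $2112$. Here a word $w_1\cdots w_m$ \emph{contains} a pattern $p=p_1\cdots p_k$ if there are indices $i_1<\dots<i_k$ such that, for all $r,s$, $w_{i_r}<w_{i_s}$ if and only if $p_r<p_s$, and $w_{i_r}=w_{i_s}$ if and only if $p_r=p_s$; otherwise $w$ \emph{avoids} $p$. For a set $\Lambda$ of words, let $\mathcal{C}_n(\Lambda)$ be the set of nonnesting permutations of $\{1,1,\dots,n,n\}$ that avoid every pattern in $\Lambda$; for $\Sigma\subseteq\mathcal{S}_3$, let $\mathcal{S}_n(\Sigma)$ be the set of permutations in $\mathcal{S}_n$ that avoid every pattern in $\Sigma$. Let $\operatorname{des}(w_1\cdots w_m)=|\{i: 1\le i<m,\ w_i>w_{i+1}\}|$ be the number of descents, and let $N_n(t)=\sum_{d=0}^{n-1}\frac1n\binom{n}{d}\binom{n}{d+1}t^d$ be the Narayana polynomial. Theorem. Let $\Sigma\subseteq\mathcal{S}_3$ and $\Lambda=\{\sigma_1\sigma_2\sigma_2\sigma_3:\sigma_1\sigma_2\sigma_3\in\Sigma\}$.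 Then, for every $n\ge1$, $$\sum_{\pi\in\mathcal{C}_n(\Lambda)} t^{\operatorname{des}(\pi)}=N_n(t)\sum_{\hat\pi\in\mathcal{S}_n(\Sigma)} t^{\operatorname{des}(\hat\pi)}.$$ In particular, for every $n\ge1$, $$\sum_{\pi\in\mathcal{C}_n(1332)} t^{\operatorname{des}(\pi)}=N_n(t)^2.$$ -/

import Mathlib

open Polynomial

namespace NonnestingPerm

/-- A word `w` of length `m` contains the pattern `p` of length `k` if some subsequence of `w`
(at increasing positions `f 0 < f 1 < ⋯`) is in the same relative order as `p`, equal letters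
of `p` corresponding to equal letters of `w`. -/
def Contains {α β : Type*} [LinearOrder α] [LinearOrder β] {m k : ℕ}
    (w : Fin m → α) (p : Fin k → β) : Prop :=
  ∃ f : Fin k ↪o Fin m, ∀ r s : Fin k,
    (w (f r) < w (f s) ↔ p r < p s) ∧ (w (f r) = w (f s) ↔ p r = p s)

/-- `w` avoids the pattern `p`. -/
def Avoids {α β : Type*} [LinearOrder α] [LinearOrder β] {m k : ℕ}
    (w : Fin m → α) (p : Fin k → β) : Prop :=
  ¬ Contains w p

/-- The number of descents of a word: the number of `i` with `w i > w (i + 1)`. -/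
def des {α : Type*} [LinearOrder α] {m : ℕ} (w : Fin m → α) : ℕ :=
  Finset.card {i : Fin m | ∃ h : (i : ℕ) + 1 < m, w ⟨(i : ℕ) + 1, h⟩ < w i}

/-- `π` is a permutation of the multiset `{1, 1, 2, 2, …, n, n}`: each letter occurs exactly
twice. The letters `1, …, n` are represented by the elements `0, …, n - 1` of `Fin n`. -/
def IsDoublePerm {n : ℕ} (π : Fin (2 * n) → Fin n) : Prop :=
  ∀ l : Fin n, Finset.card {i : Fin (2 * n) | π i = l} = 2

/-- A nonnesting permutation of `{1, 1, 2, 2, …, n, n}`: one that avoids `1221` and `2112`. -/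
def IsNonnesting {n : ℕ} (π : Fin (2 * n) → Fin n) : Prop :=
  IsDoublePerm π ∧ Avoids π (![1, 2, 2, 1] : Fin 4 → ℕ) ∧ Avoids π (![2, 1, 1, 2] : Fin 4 → ℕ)

open Classical in
/-- `𝒞ₙ(Λ)`: the nonnesting permutations of `{1, 1, …, n, n}` that avoid every pattern in `Λ`. -/
noncomputable def nonnestingAvoiding {β : Type*} [LinearOrder β] {k : ℕ} (n : ℕ)
    (Λ : Set (Fin k → β)) : Finset (Fin (2 * n) → Fin n) :=
  {π | IsNonnesting π ∧ ∀ p ∈ Λ, Avoids π p}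

open Classical in
/-- `𝒮ₙ(S)`: the permutations in `𝒮ₙ` that avoid every permutation in `S ⊆ 𝒮ₖ`. A permutation
`τ` is identified with the word `τ 0, τ 1, …` (one-line notation). -/
noncomputable def permAvoiding {k : ℕ} (n : ℕ) (S : Set (Equiv.Perm (Fin k))) :
    Finset (Equiv.Perm (Fin n)) :=
  {τ | ∀ σ ∈ S, Avoids (τ : Fin n → Fin n) (σ : Fin k → Fin k)}

/-- The word `σ₁σ₂σ₂σ₃` obtained from `σ = σ₁σ₂σ₃ ∈ 𝒮₃` by doubling the middle letter. -/
def doubleMiddle (σ : Equiv.Perm (Fin 3)) : Fin 4 → Fin 3 :=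
  ![σ 0, σ 1, σ 1, σ 2]

/-- The Narayana polynomial `Nₙ(t) = ∑_{d=0}^{n-1} (1/n) * binom(n, d) * binom(n, d+1) * t^d`
(used for `n ≥ 1`). -/
noncomputable def narayana (n : ℕ) : ℚ[X] :=
  ∑ d ∈ Finset.range n, C ((1 / (n : ℚ)) * (n.choose d : ℚ) * (n.choose (d + 1) : ℚ)) * X ^ d

end NonnestingPerm

/-!
A nonnesting permutation of `{1, 1, …, n, n}` is a shuffle of two copies of one permutation `τ`, in
which the `i`-th letter of the first copy precedes the `i`-th letter of the second; it is therefore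
given by `τ` together with a linear extension of the poset `n × 2`. A pattern with doubled middle
letter `σ₁σ₂σ₂σ₃` occurs in the shuffle if and only if `σ₁σ₂σ₃` occurs in `τ`.

The descents of the shuffles of `τ` are those of the linear extensions of `n × 2` read through a
labelling that depends on `τ`, and their distribution is determined by the number of
`(P, ω)`-partitions with values less than `m`. Subtracting from such a partition the number of
descents of `τ` to the left of each position yields an arbitrary monotone map, so `τ` contributes
only the factor `t ^ des τ`.

The other factor does not depend on `τ` and is computed with a natural labelling: linear extensions
of `n × 2` are Dyck words, and the descents become the right edges of the corresponding binary
trees, whose generating function satisfies a quadratic equation solved by Lagrange inversion. The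
permutations avoiding `132` are encoded by the same trees, by splitting at the largest letter, with
descents again at the right edges, so their descent polynomial is `Nₙ` as well.
-/

namespace NonnestingPerm

section Patterns

variable {ι κ α β γ : Type*} [LinearOrder α] [LinearOrder β] [LinearOrder γ] {m k : ℕ}

/-- Two words indexed by the same type are in the same relative order if their letters compare in
the same way at any two positions. Pattern containment is the existence of a subword in the same
relative order as the pattern. -/
def SameRelativeOrder (u : ι → α) (v : ι → β) : Prop :=
  ∀ r s, (u r < u s ↔ v r < v s) ∧ (u r = u s ↔ v r = v s)

theorem SameRelativeOrder.comp {u : ι → α} {v : ι → β} (h : SameRelativeOrder u v) (g : κ → ι) :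
    SameRelativeOrder (u ∘ g) (v ∘ g) :=
  fun r s => h (g r) (g s)

theorem SameRelativeOrder.congr_right {u : ι → α} {v : ι → β} {v' : ι → γ}
    (h : SameRelativeOrder v v') : SameRelativeOrder u v ↔ SameRelativeOrder u v' :=
  forall₂_congr fun r s => by rw [(h r s).1, (h r s).2]

theorem contains_iff {w : Fin m → α} {p : Fin k → β} :
    Contains w p ↔ ∃ f : Fin k → Fin m, StrictMono f ∧ SameRelativeOrder (w ∘ f) p :=
  ⟨fun ⟨f, hf⟩ => ⟨f, f.strictMono, hf⟩,
    fun ⟨f, hmono, hf⟩ => ⟨OrderEmbedding.ofStrictMono f hmono, hf⟩⟩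

theorem avoids_congr_right {w : Fin m → α} {p : Fin k → β} {q : Fin k → γ}
    (h : SameRelativeOrder p q) : Avoids w p ↔ Avoids w q := by
  simp only [Avoids, contains_iff, h.congr_right]

theorem avoids_comp_iff {w : Fin m → α} {p : Fin k → β} {g : α → γ} (hg : StrictMono g) :
    Avoids (g ∘ w) p ↔ Avoids w p := by
  simp only [Avoids, Contains, Function.comp_apply, hg.lt_iff_lt, hg.injective.eq_iff]

/-- The permutation `132` of `𝒮₃`. -/
def perm132 : Equiv.Perm (Fin 3) := Equiv.swap 1 2

theorem contains_perm132_iff {w : Fin m → α} :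
    Contains w perm132 ↔ ∃ i j k, i < j ∧ j < k ∧ w i < w k ∧ w k < w j := by
  rw [contains_iff]
  constructor
  · rintro ⟨f, hf, h⟩
    exact ⟨f 0, f 1, f 2, hf (by decide), hf (by decide), (h 0 2).1.2 (by decide),
      (h 2 1).1.2 (by decide)⟩
  · rintro ⟨i, j, k, hij, hjk, hik', hkj'⟩
    have hij' := hik'.trans hkj'
    refine ⟨![i, j, k], by simp [hij, hjk], fun r s => ?_⟩
    fin_cases r <;> fin_cases s <;>
      simp [perm132, Equiv.swap_apply_def, hik', hkj', hij', hik'.not_gt, hkj'.not_gt,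
        hij'.not_gt, hik'.ne, hkj'.ne, hij'.ne, hik'.ne', hkj'.ne', hij'.ne']

theorem avoids_1221_and_2112_iff {w : Fin m → α} :
    (Avoids w (![1, 2, 2, 1] : Fin 4 → ℕ) ∧ Avoids w (![2, 1, 1, 2] : Fin 4 → ℕ)) ↔
      ∀ i j k l, i < j → j < k → k < l → w i = w l → w j = w k → w i = w j := by
  simp only [Avoids, contains_iff]
  constructor
  · rintro ⟨h1221, h2112⟩ i j k l hij hjk hkl hil hjk'
    have hmono : StrictMono ![i, j, k, l] := by simp [hij, hjk, hkl]
    by_contra hne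
    rcases lt_or_gt_of_ne hne with h | h
    · refine h1221 ⟨_, hmono, fun r s => ?_⟩
      fin_cases r <;> fin_cases s <;> simp [← hil, ← hjk', h, h.not_gt, h.ne, h.ne']
    · refine h2112 ⟨_, hmono, fun r s => ?_⟩
      fin_cases r <;> fin_cases s <;> simp [← hil, ← hjk', h, h.not_gt, h.ne, h.ne']
  · intro h
    constructor
    all_goals
      rintro ⟨f, hf, hord⟩
      have h01 := h (f 0) (f 1) (f 2) (f 3) (hf (by decide)) (hf (by decide)) (hf (by decide))
        ((hord 0 3).2.2 rfl) ((hord 1 2).2.2 rfl)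
      exact absurd ((hord 0 1).2.1 h01) (by decide)

theorem doubleMiddle_eq_comp (σ : Equiv.Perm (Fin 3)) : doubleMiddle σ = σ ∘ ![0, 1, 1, 2] := by
  ext r
  fin_cases r <;> rfl

theorem sameRelativeOrder_1332_doubleMiddle_perm132 :
    SameRelativeOrder (![1, 3, 3, 2] : Fin 4 → ℕ) (doubleMiddle perm132) := by
  unfold SameRelativeOrder
  decide

end Patterns

section Descents

variable {α β : Type*} [LinearOrder α] [LinearOrder β] {n m : ℕ}

theorem des_congr {u : Fin m → α} {v : Fin m → β}
    (h : ∀ (i : Fin m) (hi : (i : ℕ) + 1 < m), u ⟨i + 1, hi⟩ < u i ↔ v ⟨i + 1, hi⟩ < v i) :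
    des u = des v := by
  simp only [des, h]

theorem des_comp_strictMono {g : α → β} (hg : StrictMono g) (w : Fin m → α) :
    des (g ∘ w) = des w :=
  des_congr fun _ _ => hg.lt_iff_lt

theorem des_eq_sum (w : Fin (n + 1) → α) :
    des w = ∑ k : Fin n, if w k.succ < w k.castSucc then 1 else 0 := by
  rw [des, Finset.card_filter, Fin.sum_univ_castSucc, if_neg (by simp), add_zero]
  exact Finset.sum_congr rfl fun k _ =>
    if_congr (exists_prop_of_true (Nat.succ_lt_succ k.isLt)) rfl rfl

/-- The number of descents of `w` before position `i`. -/
def descentsBefore (w : Fin (n + 1) → α) : Fin (n + 1) → ℕ :=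
  Fin.partialSum fun k => if w k.succ < w k.castSucc then 1 else 0

theorem descentsBefore_zero (w : Fin (n + 1) → α) : descentsBefore w 0 = 0 :=
  Fin.partialSum_zero _

theorem descentsBefore_succ (w : Fin (n + 1) → α) (k : Fin n) :
    descentsBefore w k.succ =
      descentsBefore w k.castSucc + if w k.succ < w k.castSucc then 1 else 0 :=
  Fin.partialSum_succ _ k

theorem descentsBefore_last (w : Fin (n + 1) → α) : descentsBefore w (Fin.last n) = des w := by
  rw [descentsBefore, Fin.partialSum, Fin.val_last, List.take_of_length_le (by simp),
    List.sum_ofFn, des_eq_sum]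

theorem monotone_descentsBefore (w : Fin (n + 1) → α) : Monotone (descentsBefore w) := by
  rw [Fin.monotone_iff_le_succ]
  intro i
  rw [descentsBefore_succ]
  exact Nat.le_add_right _ _

end Descents

section ProdBool

variable {α β : Type*} [PartialOrder α] [Preorder β] {f : α × Bool → β}

theorem monotone_prod_bool_iff :
    Monotone f ↔ (∀ b, Monotone fun i => f (i, b)) ∧ ∀ i, f (i, false) ≤ f (i, true) := by
  rw [monotone_prod_iff, and_comm]
  refine and_congr_right fun _ => forall_congr' fun i => ⟨fun h => h (Bool.false_le true), ?_⟩
  rintro h (_ | _) (_ | _) hab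
  exacts [le_rfl, h, absurd hab (by decide), le_rfl]

theorem strictMono_prod_bool_iff :
    StrictMono f ↔ (∀ b, StrictMono fun i => f (i, b)) ∧ ∀ i, f (i, false) < f (i, true) := by
  constructor
  · exact fun h => ⟨fun b i j hij => h (Prod.mk_lt_mk_iff_left.2 hij),
      fun i => h (Prod.mk_lt_mk_iff_right.2 Bool.false_lt_true)⟩
  · rintro ⟨hrow, hcol⟩ ⟨i, a⟩ ⟨j, b⟩ hlt
    rcases Prod.mk_lt_mk.1 hlt with ⟨hij, hab⟩ | ⟨hij : i ≤ j, hab⟩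
    · refine (hrow a hij).trans_le ?_
      rcases a with _ | _ <;> rcases b with _ | _
      exacts [le_rfl, (hcol j).le, absurd hab (by decide), le_rfl]
    · obtain ⟨rfl, rfl⟩ := Bool.lt_iff.1 hab
      rcases hij.lt_or_eq with hij | rfl
      exacts [(hrow false hij).trans (hcol j), hcol i]

end ProdBool

section PPartitions

variable {α L : Type*} [PartialOrder α] [LinearOrder L]

/-- The `(P, ω)`-partitions of a poset labelled by `ω`: the functions that are weakly increasing,
and strictly increasing along the pairs `x < y` with `ω x ≥ ω y`. -/
def IsPPartition (ω : α → L) (f : α → ℕ) : Prop :=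
  StrictMono fun x => toLex (f x, ω x)

theorem isPPartition_iff_monotone {ω : α → L} (hω : StrictMono ω) {f : α → ℕ} :
    IsPPartition ω f ↔ Monotone f := by
  rw [monotone_iff_forall_lt]
  refine forall₃_congr fun x y hxy => ?_
  simp [Prod.Lex.toLex_lt_toLex, hω hxy, le_iff_lt_or_eq]

theorem isPPartition_fin_iff {n : ℕ} {w : Fin (n + 1) → L} (hw : Function.Injective w)
    {f : Fin (n + 1) → ℕ} :
    IsPPartition w f ↔
      ∀ k : Fin n, f k.castSucc + (if w k.succ < w k.castSucc then 1 else 0) ≤ f k.succ := by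
  rw [IsPPartition, Fin.strictMono_iff_lt_succ]
  refine forall_congr' fun k => ?_
  rw [Prod.Lex.toLex_lt_toLex]
  rcases (hw.ne k.castSucc_lt_succ.ne).lt_or_gt with h | h
  · simp [h, h.not_gt, le_iff_lt_or_eq]
  · simp [h, h.not_gt]

theorem isPPartition_add_descentsBefore_iff {n : ℕ} {w : Fin (n + 1) → L}
    (hw : Function.Injective w) {g : Fin (n + 1) → ℕ} :
    IsPPartition w (g + descentsBefore w) ↔ Monotone g := by
  rw [isPPartition_fin_iff hw, Fin.monotone_iff_le_succ]
  refine forall_congr' fun k => ?_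
  simp only [Pi.add_apply, descentsBefore_succ]
  omega

theorem IsPPartition.descentsBefore_le {n : ℕ} {w : Fin (n + 1) → L} (hw : Function.Injective w)
    {f : Fin (n + 1) → ℕ} (hf : IsPPartition w f) : descentsBefore w ≤ f := by
  intro i
  induction i using Fin.induction with
  | zero => simp [descentsBefore_zero]
  | succ k ih =>
    rw [descentsBefore_succ]
    exact (Nat.add_le_add_right ih _).trans ((isPPartition_fin_iff hw).1 hf k)

variable [Fintype α]

open Classical in
/-- The `(P, ω)`-partitions with values less than `m`. -/
noncomputable def pPartitions (ω : α → L) (m : ℕ) : Finset (α → ℕ) :=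
  {f ∈ Fintype.piFinset fun _ => Finset.range m | IsPPartition ω f}

open Classical in
variable (α) in
/-- The weakly increasing functions with values less than `m`. -/
noncomputable def monotoneMaps (m : ℕ) : Finset (α → ℕ) :=
  {f ∈ Fintype.piFinset fun _ => Finset.range m | Monotone f}

open Classical in
variable (α) in
/-- The linear extensions of `α`, encoded as the enumerations `e 0, e 1, …` of `α` in which each
element is listed after all smaller ones. -/
noncomputable def linearExtensions (N : ℕ) : Finset (Fin N ≃ α) :=
  {e | StrictMono e.symm}

theorem mem_pPartitions {ω : α → L} {m : ℕ} {f : α → ℕ} :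
    f ∈ pPartitions ω m ↔ (∀ x, f x < m) ∧ IsPPartition ω f := by
  simp [pPartitions]

theorem mem_monotoneMaps {m : ℕ} {f : α → ℕ} :
    f ∈ monotoneMaps α m ↔ (∀ x, f x < m) ∧ Monotone f := by
  simp [monotoneMaps]

theorem mem_linearExtensions {N : ℕ} {e : Fin N ≃ α} :
    e ∈ linearExtensions α N ↔ StrictMono e.symm := by
  simp [linearExtensions]

theorem pPartitions_eq_monotoneMaps {ω : α → L} (hω : StrictMono ω) (m : ℕ) :
    pPartitions ω m = monotoneMaps α m := by
  ext f
  rw [mem_pPartitions, mem_monotoneMaps, isPPartition_iff_monotone hω]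

theorem monotoneMaps_zero [Nonempty α] : monotoneMaps α 0 = ∅ :=
  Finset.eq_empty_of_forall_notMem fun _ hf =>
    Nat.not_lt_zero _ ((mem_monotoneMaps.1 hf).1 (Classical.arbitrary α))

theorem monotoneMaps_one : monotoneMaps α 1 = {0} := by
  ext f
  simp only [mem_monotoneMaps, Nat.lt_one_iff, Finset.mem_singleton, funext_iff, Pi.zero_apply,
    and_iff_left_iff_imp]
  intro hf x y _
  rw [hf, hf]

theorem card_pPartitions_of_shift [OrderTop α] {ω : α → L} {δ : α → ℕ} (hδ : ∀ x, δ x ≤ δ ⊤)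
    (hshift : ∀ g, IsPPartition ω (g + δ) ↔ Monotone g)
    (hle : ∀ f, IsPPartition ω f → δ ≤ f) (m : ℕ) :
    (pPartitions ω m).card = (monotoneMaps α (m - δ ⊤)).card := by
  symm
  refine Finset.card_bij (fun g _ => g + δ) ?_ (fun _ _ _ _ h => add_right_cancel h) ?_
  · intro g hg
    rw [mem_monotoneMaps] at hg
    refine mem_pPartitions.2 ⟨fun x => ?_, (hshift g).2 hg.2⟩
    have := hg.1 x
    have := hδ x
    rw [Pi.add_apply]
    omega
  · intro f hf
    rw [mem_pPartitions] at hf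
    have hadd : f - δ + δ = f := tsub_add_cancel_of_le (hle f hf.2)
    have hmono : Monotone (f - δ) := (hshift _).1 (hadd.symm ▸ hf.2)
    refine ⟨f - δ, mem_monotoneMaps.2 ⟨fun x => (hmono le_top).trans_lt ?_, hmono⟩, hadd⟩
    exact Nat.sub_lt_sub_right (hle f hf.2 ⊤) (hf.1 ⊤)

theorem card_pPartitions_fin {n : ℕ} {w : Fin (n + 1) → L} (hw : Function.Injective w) (m : ℕ) :
    (pPartitions w m).card = (monotoneMaps (Fin (n + 1)) (m - des w)).card := by
  rw [← descentsBefore_last]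
  exact card_pPartitions_of_shift (δ := descentsBefore w)
    (fun x => monotone_descentsBefore w le_top) (fun _ => isPPartition_add_descentsBefore_iff hw)
    (fun _ hf => hf.descentsBefore_le hw) m

end PPartitions

section Translates

variable {R : Type*} [CommRing R] {ι κ : Type*} {s : Finset ι} {t : Finset κ} {f : ι → ℕ}
  {g : κ → ℕ} {B : ℕ → ℕ}

theorem coeff_sum_X_pow_mul_mk (hB₀ : B 0 = 0) (m : ℕ) :
    PowerSeries.coeff m (((∑ i ∈ s, (X : R[X]) ^ f i : R[X]) : PowerSeries R) *
      PowerSeries.mk fun k => (B k : R)) = ((∑ i ∈ s, B (m - f i) : ℕ) : R) := by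
  rw [← coeToPowerSeries.ringHom_apply, map_sum, Finset.sum_mul, map_sum, Nat.cast_sum]
  refine Finset.sum_congr rfl fun i _ => ?_
  rw [map_pow, coeToPowerSeries.ringHom_apply, coe_X, PowerSeries.coeff_X_pow_mul']
  split_ifs with hd
  · rw [PowerSeries.coeff_mk]
  · rw [Nat.sub_eq_zero_of_le (not_le.1 hd).le, hB₀, Nat.cast_zero]

theorem sum_X_pow_eq_of_sum_translates_eq [IsDomain R] (hB₀ : B 0 = 0) (hB₁ : B 1 = 1)
    (h : ∀ m, ∑ i ∈ s, B (m - f i) = ∑ j ∈ t, B (m - g j)) :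
    ∑ i ∈ s, (X : R[X]) ^ f i = ∑ j ∈ t, (X : R[X]) ^ g j := by
  have hB : PowerSeries.mk (fun k => (B k : R)) ≠ 0 := fun h0 => by
    simpa [hB₁] using congrArg (PowerSeries.coeff 1) h0
  apply coe_injective R
  apply mul_right_cancel₀ hB
  ext m
  rw [coeff_sum_X_pow_mul_mk hB₀, coeff_sum_X_pow_mul_mk hB₀, h]

end Translates

section LinearExtensions

theorem exists_equiv_strictMono_comp {β K : Type*} [Fintype β] [LinearOrder K] {N : ℕ}
    (hN : Fintype.card β = N) {key : β → K} (hkey : Function.Injective key) :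
    ∃ e : Fin N ≃ β, StrictMono (key ∘ e) := by
  let e₀ : Fin N ≃ β := (Fintype.equivFinOfCardEq hN).symm
  let σ := Tuple.sort (key ∘ e₀)
  exact ⟨σ.trans e₀, (Tuple.monotone_sort (key ∘ e₀)).strictMono_of_injective
    ((hkey.comp e₀.injective).comp σ.injective)⟩

theorem equiv_eq_of_strictMono_comp {β K : Type*} [LinearOrder K] {N : ℕ} {key : β → K}
    (hkey : Function.Injective key) {e e' : Fin N ≃ β} (h : StrictMono (key ∘ e))
    (h' : StrictMono (key ∘ e')) : e = e' := by
  have := (StrictMono.range_inj h h').1 (by rw [e.surjective.range_comp, e'.surjective.range_comp])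
  ext k
  exact hkey (congrFun this k)

variable {α L L' : Type*} [Fintype α] [PartialOrder α] [LinearOrder L] [LinearOrder L']

/-- The fundamental lemma of `(P, ω)`-partitions. -/
theorem card_pPartitions_eq_sum {N : ℕ} (hN : Fintype.card α = N) {ω : α → L}
    (hω : Function.Injective ω) (m : ℕ) :
    (pPartitions ω m).card = ∑ e ∈ linearExtensions α N, (pPartitions (ω ∘ e) m).card := by
  rw [← Finset.card_sigma]
  symm
  have hkey (f : α → ℕ) : Function.Injective fun x => toLex (f x, ω x) := fun x y h =>
    hω (Prod.ext_iff.1 (toLex.injective h)).2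
  have hsort {e : Fin N ≃ α} {a : Fin N → ℕ} (h : IsPPartition (ω ∘ e) a) :
      StrictMono ((fun x => toLex ((a ∘ e.symm) x, ω x)) ∘ e) := by
    simpa [Function.comp_def, IsPPartition] using h
  refine Finset.card_bij (fun p _ => p.2 ∘ p.1.symm) ?_ ?_ ?_
  · rintro ⟨e, a⟩ h
    simp only [Finset.mem_sigma, mem_linearExtensions, mem_pPartitions] at h ⊢
    refine ⟨fun x => h.2.1 _, fun x y hxy => ?_⟩
    simpa using h.2.2 (h.1 hxy)
  · rintro ⟨e, a⟩ h ⟨e', a'⟩ h' heq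
    simp only [Finset.mem_sigma, mem_linearExtensions, mem_pPartitions] at h h' heq
    obtain rfl := equiv_eq_of_strictMono_comp (hkey _) (hsort h.2.2) (heq ▸ hsort h'.2.2)
    obtain rfl := e.symm.surjective.injective_comp_right heq
    rfl
  · intro f hf
    rw [mem_pPartitions] at hf
    obtain ⟨e, he⟩ := exists_equiv_strictMono_comp hN (hkey f)
    refine ⟨⟨e, f ∘ e⟩, ?_, by ext x; simp⟩
    simp only [Finset.mem_sigma, mem_linearExtensions, mem_pPartitions]
    refine ⟨fun x y hxy => ?_, fun i => hf.1 _, he⟩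
    rw [← he.lt_iff_lt]
    simpa using hf.2 hxy

theorem sum_X_pow_des_eq_of_card_pPartitions_eq (R : Type*) [CommRing R] [IsDomain R]
    [Nonempty α] {N d : ℕ} (hN : Fintype.card α = N) {ω : α → L} {ω' : α → L'}
    (hω : Function.Injective ω) (hω' : Function.Injective ω')
    (h : ∀ m, (pPartitions ω m).card = (pPartitions ω' (m - d)).card) :
    ∑ e ∈ linearExtensions α N, (X : R[X]) ^ des (ω ∘ e) =
      X ^ d * ∑ e ∈ linearExtensions α N, (X : R[X]) ^ des (ω' ∘ e) := by
  obtain ⟨n, rfl⟩ := Nat.exists_eq_add_one.2 (hN ▸ Fintype.card_pos)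
  simp only [Finset.mul_sum, ← pow_add]
  refine sum_X_pow_eq_of_sum_translates_eq
    (B := fun k => (monotoneMaps (Fin (n + 1)) k).card) (by simp [monotoneMaps_zero])
    (by simp [monotoneMaps_one]) fun m => ?_
  simpa only [card_pPartitions_eq_sum hN hω, card_pPartitions_eq_sum hN hω',
    card_pPartitions_fin (hω.comp (Equiv.injective _)),
    card_pPartitions_fin (hω'.comp (Equiv.injective _)), Nat.sub_sub] using h m

end LinearExtensions

section DoubledPoset

variable {α L : Type*}

/-- The labelling of `α × Bool` whose `(P, ω)`-partitions are the pairs of pointwise comparable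
`(P, τ)`-partitions: it orders by the label of the `α`-component first, so a linear extension of
`α × Bool` read through it has descents as the corresponding word in which each letter `τ i`
occurs twice. -/
def doubleLabel (τ : α → L) (x : α × Bool) : L ×ₗ Bool := toLex (τ x.1, x.2)

theorem doubleLabel_injective {τ : α → L} (hτ : Function.Injective τ) :
    Function.Injective (doubleLabel τ) :=
  toLex.injective.comp (hτ.prodMap Function.injective_id)

/-- A labelling of `α × Bool` that is increasing, and whose descents along a linear extension are
those of the `Bool`-component. -/
def rowLabel (x : α × Bool) : Bool ×ₗ α := toLex x.swap

theorem rowLabel_injective : Function.Injective (rowLabel : α × Bool → Bool ×ₗ α) :=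
  toLex.injective.comp Prod.swap_injective

variable [PartialOrder α] [LinearOrder L]

theorem isPPartition_doubleLabel_iff {τ : α → L} (hτ : Function.Injective τ)
    {f : α × Bool → ℕ} :
    IsPPartition (doubleLabel τ) f ↔
      (∀ b, IsPPartition τ fun i => f (i, b)) ∧ ∀ i, f (i, false) ≤ f (i, true) := by
  rw [IsPPartition, strictMono_prod_bool_iff]
  refine and_congr (forall_congr' fun b => forall₃_congr fun i j hij => ?_)
    (forall_congr' fun i => ?_)
  · simp [Prod.Lex.toLex_lt_toLex, doubleLabel, hτ.ne hij.ne]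
  · simp [Prod.Lex.toLex_lt_toLex, doubleLabel, le_iff_lt_or_eq]

theorem card_pPartitions_doubleLabel {n : ℕ} {τ : Fin (n + 1) → L} (hτ : Function.Injective τ)
    (m : ℕ) :
    (pPartitions (doubleLabel τ) m).card =
      (monotoneMaps (Fin (n + 1) × Bool) (m - des τ)).card := by
  rw [← descentsBefore_last]
  refine card_pPartitions_of_shift (δ := descentsBefore τ ∘ Prod.fst)
    (fun x => monotone_descentsBefore τ le_top) (fun g => ?_) (fun f hf x => ?_) m
  · rw [isPPartition_doubleLabel_iff hτ, monotone_prod_bool_iff]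
    exact and_congr (forall_congr' fun b => isPPartition_add_descentsBefore_iff hτ)
      (forall_congr' fun i => add_le_add_iff_right _)
  · exact (((isPPartition_doubleLabel_iff hτ).1 hf).1 x.2).descentsBefore_le hτ x.1

theorem rowLabel_strictMono : StrictMono (rowLabel : α × Bool → Bool ×ₗ α) :=
  Prod.Lex.toLex_strictMono.comp fun _ _ => Prod.swap_lt_swap.2

/-- Subtracting the descents of `τ` turns the `(P, ω)`-partitions of the doubled poset into
arbitrary monotone maps, so `τ` only enters through its number of descents. -/
theorem sum_X_pow_des_doubleLabel (R : Type*) [CommRing R] [IsDomain R] {n : ℕ} (hn : 1 ≤ n)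
    {τ : Fin n → L} (hτ : Function.Injective τ) :
    ∑ e ∈ linearExtensions (Fin n × Bool) (2 * n), (X : R[X]) ^ des (doubleLabel τ ∘ e) =
      X ^ des τ *
        ∑ e ∈ linearExtensions (Fin n × Bool) (2 * n), (X : R[X]) ^ des (rowLabel ∘ e) := by
  obtain ⟨n, rfl⟩ := Nat.exists_eq_add_of_le' hn
  refine sum_X_pow_des_eq_of_card_pPartitions_eq R (by simp [mul_comm])
    (doubleLabel_injective hτ) rowLabel_injective fun m => ?_
  rw [card_pPartitions_doubleLabel hτ, pPartitions_eq_monotoneMaps rowLabel_strictMono]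

end DoubledPoset

section LagrangeInversion

variable {R : Type*} [CommRing R] {φ : R[X]} {H : PowerSeries R}

theorem coeff_pow_of_eq_X_mul_aeval (hH : H = PowerSeries.X * aeval H φ) (m j : ℕ) :
    PowerSeries.coeff m (H ^ j) =
      if j ≤ m then PowerSeries.coeff (m - j) (aeval H (φ ^ j)) else 0 := by
  have hpow : H ^ j = PowerSeries.X ^ j * aeval H (φ ^ j) := by
    rw [map_pow, ← mul_pow, ← hH]
  rw [hpow, PowerSeries.coeff_X_pow_mul']

theorem coeff_zero_aeval_of_eq_X_mul_aeval (hH : H = PowerSeries.X * aeval H φ) (ψ : R[X]) :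
    PowerSeries.coeff 0 (aeval H ψ) = ψ.coeff 0 := by
  have hH₀ : PowerSeries.constantCoeff H = 0 := by
    rw [hH, map_mul, PowerSeries.constantCoeff_X, zero_mul]
  rw [PowerSeries.coeff_zero_eq_constantCoeff_apply, aeval_def, hom_eval₂, hH₀,
    eval₂_at_zero]
  simp

theorem coeff_X_mul_derivative (ψ : R[X]) (m : ℕ) :
    (X * derivative ψ).coeff m = m * ψ.coeff m := by
  rcases m with _ | m
  · simp
  · rw [coeff_X_mul, coeff_derivative, mul_comm, Nat.cast_succ]

theorem natCast_add_mul_derivative_pow_mul_pow (φ : R[X]) (j k : ℕ) :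
    ((j + k : ℕ) : R[X]) * (derivative (φ ^ j) * φ ^ k) = j * derivative (φ ^ (j + k)) := by
  rcases j with _ | j
  · simp
  · rw [derivative_pow, derivative_pow, Nat.add_sub_cancel, Nat.add_right_comm,
      Nat.add_sub_cancel, pow_add]
    simp only [map_natCast]
    ring

/-- The Lagrange–Bürmann formula. -/
theorem natCast_mul_coeff_aeval_of_eq_X_mul_aeval [IsAddTorsionFree R]
    (hH : H = PowerSeries.X * aeval H φ) (m : ℕ) (ψ : R[X]) :
    m * PowerSeries.coeff m (aeval H ψ) = (X * derivative ψ * φ ^ m).coeff m := by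
  induction m using Nat.strong_induction_on generalizing ψ with
  | _ m ih =>
  suffices hpow : ∀ j : ℕ, m * PowerSeries.coeff m (H ^ j) = j * (X ^ j * φ ^ m).coeff m by
    induction ψ using Polynomial.induction_on' with
    | add p q hp hq => simp only [map_add, mul_add, add_mul, coeff_add, hp, hq]
    | monomial j a =>
      have hX : X * derivative (X ^ j) = (j : R[X]) * X ^ j := by
        rcases j with _ | j
        · simp
        · rw [derivative_X_pow, Nat.add_sub_cancel, map_natCast, mul_left_comm, ← pow_succ']
      rw [← smul_X_eq_monomial, map_smul, map_pow, aeval_X, PowerSeries.coeff_smul, smul_eq_mul,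
        mul_left_comm, hpow, derivative_smul, mul_smul_comm, smul_mul_assoc, coeff_smul,
        smul_eq_mul, hX, mul_assoc, coeff_natCast_mul]
  intro j
  rw [coeff_X_pow_mul', coeff_pow_of_eq_X_mul_aeval hH]
  split_ifs with hjm
  swap
  · rw [mul_zero, mul_zero]
  obtain ⟨k, rfl⟩ := Nat.exists_eq_add_of_le hjm
  rw [Nat.add_sub_cancel_left]
  rcases Nat.eq_zero_or_pos k with rfl | hk
  · rw [coeff_zero_aeval_of_eq_X_mul_aeval hH, add_zero]
  rcases Nat.eq_zero_or_pos j with rfl | hj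
  · simp [PowerSeries.coeff_one, hk.ne']
  refine nsmul_right_injective hk.ne' ?_
  dsimp only
  rw [nsmul_eq_mul, nsmul_eq_mul, mul_left_comm, ih k (Nat.lt_add_of_pos_left hj),
    ← coeff_natCast_mul, mul_assoc X, mul_left_comm, natCast_add_mul_derivative_pow_mul_pow,
    mul_left_comm, coeff_natCast_mul, coeff_X_mul_derivative, mul_left_comm]

theorem natCast_add_one_mul_coeff_add_one_of_eq_X_mul_aeval [IsAddTorsionFree R]
    (hH : H = PowerSeries.X * aeval H φ) (n : ℕ) :
    ((n + 1 : ℕ) : R) * PowerSeries.coeff (n + 1) H = (φ ^ (n + 1)).coeff n := by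
  simpa using natCast_mul_coeff_aeval_of_eq_X_mul_aeval hH (n + 1) X

end LagrangeInversion

section Narayana

/-- The number of nodes of a binary tree that have a nonempty right subtree. -/
def rightCount : BinaryTree Unit → ℕ
  | .nil => 0
  | .node _ l r => rightCount l + rightCount r + if r.numNodes = 0 then 0 else 1

/-- The generating polynomial of the binary trees with `n` nodes by `rightCount`. -/
noncomputable def treePoly (n : ℕ) : ℚ[X] :=
  ∑ T ∈ BinaryTree.treesOfNumNodesEq n, X ^ rightCount T

theorem treePoly_zero : treePoly 0 = 1 := by
  simp [treePoly, rightCount]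

theorem treePoly_succ (n : ℕ) :
    treePoly (n + 1) = ∑ ij ∈ Finset.HasAntidiagonal.antidiagonal n,
      treePoly ij.1 * (treePoly ij.2 * if ij.2 = 0 then 1 else X) := by
  rw [treePoly, BinaryTree.treesOfNumNodesEq_succ, Finset.sum_biUnion]
  · refine Finset.sum_congr rfl fun ij _ => ?_
    rw [Finset.sum_map, Finset.sum_product, treePoly, treePoly, Finset.sum_mul]
    refine Finset.sum_congr rfl fun l _ => ?_
    rw [Finset.sum_mul, Finset.mul_sum]
    refine Finset.sum_congr rfl fun r hr => ?_
    rw [BinaryTree.mem_treesOfNumNodesEq] at hr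
    change X ^ rightCount (BinaryTree.node () l r) = _
    rw [rightCount, hr, pow_add, pow_add]
    split_ifs <;> ring
  · simp_rw [Set.PairwiseDisjoint, Set.Pairwise, Finset.disjoint_left]
    aesop

theorem mk_treePoly_eq :
    PowerSeries.mk treePoly = 1 + PowerSeries.X * (PowerSeries.mk treePoly *
      (1 + PowerSeries.C (X : ℚ[X]) * (PowerSeries.mk treePoly - 1))) := by
  ext1 n
  rcases n with _ | n
  · simp [treePoly_zero]
  · rw [map_add, PowerSeries.coeff_succ_X_mul, PowerSeries.coeff_mul, PowerSeries.coeff_mk,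
      treePoly_succ, PowerSeries.coeff_one, if_neg (Nat.succ_ne_zero n), zero_add]
    refine Finset.sum_congr rfl fun ij _ => ?_
    rw [PowerSeries.coeff_mk, map_add, PowerSeries.coeff_C_mul, map_sub, PowerSeries.coeff_mk,
      PowerSeries.coeff_one]
    split_ifs with h
    · rw [h, treePoly_zero]
      ring
    · ring

theorem coeff_one_add_C_mul_X_mul_one_add_X_pow {R : Type*} [CommSemiring R] (t : R) (n k : ℕ) :
    (((1 + C t * X) * (1 + X)) ^ n : R[X]).coeff k =
      ∑ d ∈ Finset.range (k + 1), (n.choose d * n.choose (k - d) : ℕ) * t ^ d := by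
  have hcomp : (1 + C t * X : R[X]) ^ n = ((1 + X) ^ n : R[X]).comp (C t * X) := by simp
  rw [mul_pow, coeff_mul, Finset.Nat.sum_antidiagonal_eq_sum_range_succ_mk]
  refine Finset.sum_congr rfl fun d _ => ?_
  rw [hcomp, comp_C_mul_X_coeff, coeff_one_add_X_pow, coeff_one_add_X_pow, Nat.cast_mul]
  exact mul_right_comm _ _ _

theorem natCast_mul_coeff_of_quadratic {R : Type*} [CommRing R] [IsAddTorsionFree R] {t : R}
    {F : PowerSeries R}
    (hF : F = 1 + PowerSeries.X * (F * (1 + PowerSeries.C t * (F - 1)))) (n : ℕ) :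
    ((n + 1 : ℕ) : R) * PowerSeries.coeff (n + 1) F =
      ∑ d ∈ Finset.range (n + 1), ((n + 1).choose d * (n + 1).choose (d + 1) : ℕ) * t ^ d := by
  have hH : F - 1 = PowerSeries.X * aeval (F - 1) ((1 + C t * X) * (1 + X) : R[X]) := by
    rw [sub_eq_iff_eq_add']
    nth_rw 1 [hF]
    simp only [map_mul, map_add, map_one, aeval_C, aeval_X, ← PowerSeries.algebraMap_eq]
    ring
  have hcoeff := natCast_add_one_mul_coeff_add_one_of_eq_X_mul_aeval hH n
  rw [map_sub, PowerSeries.coeff_one, if_neg n.succ_ne_zero, sub_zero] at hcoeff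
  rw [hcoeff, coeff_one_add_C_mul_X_mul_one_add_X_pow]
  refine Finset.sum_congr rfl fun d hd => ?_
  rw [Nat.choose_symm_of_eq_add (a := n - d) (b := d + 1) (by grind)]

theorem natCast_mul_narayana (n : ℕ) :
    (n : ℚ[X]) * narayana n =
      ∑ d ∈ Finset.range n, (n.choose d * n.choose (d + 1) : ℕ) * X ^ d := by
  rcases Nat.eq_zero_or_pos n with rfl | hn
  · simp
  rw [narayana, Finset.mul_sum]
  refine Finset.sum_congr rfl fun d _ => ?_
  have hn' : (n : ℚ) ≠ 0 := Nat.cast_ne_zero.2 hn.ne'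
  rw [← mul_assoc, ← map_natCast C, ← map_natCast C, ← map_mul]
  congr 2
  push_cast
  field_simp

theorem treePoly_eq_narayana {n : ℕ} (hn : 1 ≤ n) : treePoly n = narayana n := by
  obtain ⟨n, rfl⟩ := Nat.exists_eq_add_of_le' hn
  refine mul_left_cancel₀ (Nat.cast_ne_zero.2 n.succ_ne_zero : ((n + 1 : ℕ) : ℚ[X]) ≠ 0) ?_
  rw [natCast_mul_narayana, ← natCast_mul_coeff_of_quadratic mk_treePoly_eq, PowerSeries.coeff_mk]

end Narayana

section FiberEnumeration

variable {ι β κ : Type*} [LinearOrder ι] [LinearOrder κ]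

theorem exists_equiv_prod_of_card_fiber [Fintype ι] [Fintype κ] [DecidableEq β] {w : ι → β}
    (h : ∀ b, Finset.card {i | w i = b} = Fintype.card κ) :
    ∃ e : ι ≃ β × κ, (∀ i, (e i).1 = w i) ∧ ∀ b, StrictMono fun j => e.symm (b, j) := by
  let f (b : β) : {i // w i = b} ≃o κ :=
    (monoEquivOfFin _ ((Fintype.card_subtype _).trans (h b))).symm.trans (monoEquivOfFin κ rfl)
  exact ⟨(Equiv.sigmaFiberEquiv w).symm.trans
    ((Equiv.sigmaCongrRight fun b => (f b).toEquiv).trans (Equiv.sigmaEquivProd β κ)),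
    fun _ => rfl, fun b => (f b).symm.strictMono⟩

theorem equiv_prod_eq_of_strictMono [WellFoundedLT κ] {e e' : ι ≃ β × κ}
    (hfst : ∀ i, (e i).1 = (e' i).1) (h : ∀ b, StrictMono fun j => e.symm (b, j))
    (h' : ∀ b, StrictMono fun j => e'.symm (b, j)) : e = e' := by
  have range_symm (e : ι ≃ β × κ) (b : β) :
      Set.range (fun j => e.symm (b, j)) = {i | (e i).1 = b} := by
    ext i
    simp [e.symm_apply_eq, Prod.ext_iff, eq_comm]
  have hsymm (b : β) : (fun j => e.symm (b, j)) = fun j => e'.symm (b, j) := by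
    rw [← StrictMono.range_inj (h b) (h' b), range_symm, range_symm]
    simp only [hfst]
  exact Equiv.symm_bijective.injective (Equiv.ext fun x => congrFun (hsymm x.1) x.2)

end FiberEnumeration

section LinearExtensionsProdBool

variable {α L : Type*} [PartialOrder α] [Fintype α] [LinearOrder L] {N : ℕ} {e : Fin N ≃ α × Bool}

theorem mem_linearExtensions_prod_bool :
    e ∈ linearExtensions (α × Bool) N ↔
      (∀ b, StrictMono fun i => e.symm (i, b)) ∧ ∀ i, e.symm (i, false) < e.symm (i, true) := by
  rw [mem_linearExtensions, strictMono_prod_bool_iff]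

theorem not_lt_of_mem_linearExtensions (he : e ∈ linearExtensions (α × Bool) N) (k : Fin N)
    (hk : (k : ℕ) + 1 < N) : ¬ e ⟨k + 1, hk⟩ < e k := fun h => by
  have := mem_linearExtensions.1 he h
  simp [Fin.lt_def] at this

theorem des_doubleLabel_comp (he : e ∈ linearExtensions (α × Bool) N) {τ : α → L}
    (hτ : Function.Injective τ) : des (doubleLabel τ ∘ e) = des fun k => τ (e k).1 := by
  refine des_congr fun k hk => ?_
  have hnot := not_lt_of_mem_linearExtensions he k hk
  rw [Function.comp_apply, Function.comp_apply, doubleLabel, doubleLabel, Prod.Lex.toLex_lt_toLex]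
  exact or_iff_left fun ⟨hfst, hsnd⟩ =>
    hnot (Prod.mk_lt_mk.2 (Or.inr ⟨(hτ hfst).le, hsnd⟩))

theorem des_rowLabel_comp {α : Type*} [LinearOrder α] [Fintype α] {e : Fin N ≃ α × Bool}
    (he : e ∈ linearExtensions (α × Bool) N) :
    des (rowLabel ∘ e) = des fun k => (e k).2 := by
  refine des_congr fun k hk => ?_
  have hnot := not_lt_of_mem_linearExtensions he k hk
  rw [Function.comp_apply, Function.comp_apply, rowLabel, rowLabel, Prod.Lex.toLex_lt_toLex]
  exact or_iff_left fun ⟨hsnd, hfst⟩ => hnot (Prod.mk_lt_mk.2 (Or.inl ⟨hfst, hsnd.le⟩))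

end LinearExtensionsProdBool

section ListDescents

variable {α : Type*} [LinearOrder α] {L R : List α} {M : α}

/-- The number of descents of a word given as a list. -/
def listDes : List α → ℕ
  | [] => 0
  | [_] => 0
  | a :: b :: l => (if b < a then 1 else 0) + listDes (b :: l)

theorem des_eq_listDes {n : ℕ} (w : Fin n → α) : des w = listDes (List.ofFn w) := by
  induction n with
  | zero => simp [des, listDes]
  | succ n ih =>
    rcases n with _ | n
    · rw [des_eq_sum]
      simp [listDes]
    · have htail := ih fun i => w i.succ
      rw [List.ofFn_succ, des_eq_sum] at htail
      rw [des_eq_sum, Fin.sum_univ_succ, List.ofFn_succ, List.ofFn_succ, listDes, ← htail]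
      rfl

theorem listDes_append_cons (h : ∀ a ∈ L, a ≤ M) :
    listDes (L ++ M :: R) = listDes L + listDes (M :: R) := by
  induction L with
  | nil => simp [listDes]
  | cons a L ih =>
    have ih := ih fun x hx => h x (List.mem_cons_of_mem _ hx)
    rcases L with _ | ⟨b, L⟩
    · simp [listDes, (h a (by simp)).not_gt]
    · rw [List.cons_append, List.cons_append, listDes, ← List.cons_append, ih, listDes, add_assoc]

theorem listDes_cons_of_head_lt (h : ∀ a ∈ R.head?, a < M) :
    listDes (M :: R) = listDes R + if R.length = 0 then 0 else 1 := by
  rcases R with _ | ⟨a, R⟩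
  · simp [listDes]
  · simp [listDes, h a (by simp), add_comm]

theorem listDes_cons_of_le_head (h : ∀ a ∈ R.head?, M ≤ a) : listDes (M :: R) = listDes R := by
  rcases R with _ | ⟨a, R⟩
  · simp [listDes]
  · simp [listDes, (h a (by simp)).not_gt]

end ListDescents

section DyckWords

/-- The step of a Dyck path encoded by a boolean, `true` standing for a down step. -/
def dyckStep (b : Bool) : DyckStep := if b then .D else .U

theorem dyckStep_injective : Function.Injective dyckStep := by decide

/-- The inverse image of a Dyck word under the encoding `dyckStep` of steps by booleans. -/
def boolWord (p : DyckWord) : List Bool := p.toList.map (· == DyckStep.D)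

theorem map_dyckStep_boolWord (p : DyckWord) : (boolWord p).map dyckStep = p.toList := by
  have hinv : dyckStep ∘ (· == DyckStep.D) = id := by
    ext s
    cases s <;> rfl
  rw [boolWord, List.map_map, hinv, List.map_id]

theorem count_map_dyckStep (l : List Bool) (b : Bool) :
    (l.map dyckStep).count (dyckStep b) = l.count b :=
  List.count_map_of_injective _ _ dyckStep_injective _

theorem length_boolWord (p : DyckWord) : (boolWord p).length = 2 * p.semilength := by
  rw [boolWord, List.length_map, DyckWord.two_mul_semilength_eq_length]

theorem count_boolWord (p : DyckWord) (b : Bool) : (boolWord p).count b = p.semilength := by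
  rw [← count_map_dyckStep, map_dyckStep_boolWord]
  cases b
  · rfl
  · exact p.semilength_eq_count_D.symm

theorem count_true_take_boolWord_le (p : DyckWord) (i : ℕ) :
    ((boolWord p).take i).count true ≤ ((boolWord p).take i).count false := by
  rw [← count_map_dyckStep, ← count_map_dyckStep, List.map_take, map_dyckStep_boolWord]
  exact p.count_D_le_count_U i

theorem eq_false_of_mem_head?_boolWord (p : DyckWord) : ∀ a ∈ (boolWord p).head?, a = false := by
  intro a ha
  by_cases h : p.toList = []
  · simp [boolWord, h] at ha
  · rw [boolWord, List.head?_map, List.head?_eq_some_head h, DyckWord.head_eq_U] at ha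
    exact (Option.some.inj ha).symm

theorem semilength_ofTree (T : BinaryTree Unit) : (DyckWord.ofTree T).semilength = T.numNodes := by
  rw [← DyckWord.numNodes_toTree, DyckWord.toTree_ofTree]

theorem boolWord_ofTree_node (a : Unit) (l r : BinaryTree Unit) :
    boolWord (DyckWord.ofTree (.node a l r)) =
      (false :: boolWord (DyckWord.ofTree l)) ++ true :: boolWord (DyckWord.ofTree r) := by
  change (([DyckStep.U] ++ (DyckWord.ofTree l).toList ++ [DyckStep.D]) ++
    (DyckWord.ofTree r).toList).map _ = _
  simp [boolWord]

theorem listDes_boolWord_ofTree (T : BinaryTree Unit) :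
    listDes (boolWord (DyckWord.ofTree T)) = rightCount T := by
  induction T with
  | nil => rfl
  | node a l r ihl ihr =>
    rw [boolWord_ofTree_node, listDes_append_cons fun a _ => Bool.le_true a,
      listDes_cons_of_le_head fun a _ => Bool.false_le a, listDes_cons_of_head_lt,
      length_boolWord, semilength_ofTree, ihl, ihr, rightCount, add_assoc]
    · simp
    · intro a ha
      rw [eq_false_of_mem_head?_boolWord _ a ha]
      exact Bool.false_lt_true

end DyckWords

section RowWords

theorem exists_ofFn_eq {α : Type*} {l : List α} {n : ℕ} (h : l.length = n) :
    ∃ w : Fin n → α, List.ofFn w = l := by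
  subst h
  exact ⟨l.get, List.ofFn_get l⟩

theorem count_take_ofFn {α : Type*} [DecidableEq α] {N : ℕ} (w : Fin N → α) (a : α) (i : ℕ) :
    ((List.ofFn w).take i).count a = Finset.card {k : Fin N | (k : ℕ) < i ∧ w k = a} := by
  have count_eq_sum (l : List α) : l.count a = (l.map fun x => if x = a then 1 else 0).sum := by
    induction l with
    | nil => rfl
    | cons b l ih => simp [List.count_cons, ih, add_comm]
  rw [count_eq_sum, List.map_take, List.map_ofFn, List.sum_take_ofFn, Finset.card_filter,
    Finset.sum_filter]
  refine Finset.sum_congr rfl fun k _ => ?_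
  by_cases h : (k : ℕ) < i <;> simp [h]

theorem forall_le_iff_card_filter_lt_le {n : ℕ} {f g : Fin n → ℕ} (hf : Monotone f)
    (hg : Monotone g) :
    (∀ j, f j ≤ g j) ↔
      ∀ i, Finset.card {j | g j < i} ≤ Finset.card {j | f j < i} := by
  refine ⟨fun h i => Finset.card_le_card
    (Finset.monotone_filter_right _ fun j _ hj => (h j).trans_lt hj), fun h j => ?_⟩
  rw [← Nat.lt_succ_iff, ← Tuple.lt_card_lt_iff_apply_lt_of_monotone hf]
  exact ((Tuple.lt_card_lt_iff_apply_lt_of_monotone hg).2 (Nat.lt_succ_self _)).trans_le (h _)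

/-- The sequence of `Bool`-components of an enumeration of `α × Bool`. -/
def rowWord {α : Type*} {N : ℕ} (e : Fin N ≃ α × Bool) : List Bool := List.ofFn fun k => (e k).2

theorem count_take_rowWord {α : Type*} [Fintype α] {N : ℕ} (e : Fin N ≃ α × Bool) (b : Bool)
    (i : ℕ) :
    ((rowWord e).take i).count b = Finset.card {j : α | (e.symm (j, b) : ℕ) < i} := by
  rw [rowWord, count_take_ofFn]
  refine Finset.card_nbij' (fun k => (e k).1) (fun j => e.symm (j, b)) ?_ ?_ ?_ ?_
  · rintro k hk
    obtain ⟨hki, rfl⟩ := (Finset.mem_filter.1 hk).2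
    simpa using hki
  · intro j hj
    simpa using hj
  · rintro k hk
    obtain ⟨-, rfl⟩ := (Finset.mem_filter.1 hk).2
    simp
  · intro j _
    simp

theorem mem_linearExtensions_iff_count_take_le {n N : ℕ} {e : Fin N ≃ Fin n × Bool} :
    e ∈ linearExtensions (Fin n × Bool) N ↔
      (∀ b, StrictMono fun j => e.symm (j, b)) ∧
        ∀ i, ((rowWord e).take i).count true ≤ ((rowWord e).take i).count false := by
  simp only [mem_linearExtensions_prod_bool, count_take_rowWord]
  refine and_congr_right fun hrow => ?_
  rw [← forall_le_iff_card_filter_lt_le (hrow false).monotone (hrow true).monotone]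
  refine forall_congr' fun j => ⟨le_of_lt, fun h => lt_of_le_of_ne h ?_⟩
  simp

variable {n : ℕ} {e : Fin (2 * n) ≃ Fin n × Bool}

/-- The Dyck word whose down steps are the positions of the elements `(i, true)` in a linear
extension of `Fin n × Bool`. -/
def dyckOfLinearExtension (he : e ∈ linearExtensions (Fin n × Bool) (2 * n)) : DyckWord where
  toList := (rowWord e).map dyckStep
  count_U_eq_count_D := by
    have hcount (b : Bool) : ((rowWord e).map dyckStep).count (dyckStep b) = n := by
      rw [count_map_dyckStep, ← List.take_length (l := rowWord e), count_take_rowWord]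
      simp [rowWord]
    exact (hcount false).trans (hcount true).symm
  count_D_le_count_U i := by
    have hle := (mem_linearExtensions_iff_count_take_le.1 he).2 i
    rwa [← count_map_dyckStep, ← count_map_dyckStep, List.map_take] at hle

theorem boolWord_dyckOfLinearExtension (he : e ∈ linearExtensions (Fin n × Bool) (2 * n)) :
    boolWord (dyckOfLinearExtension he) = rowWord e :=
  List.map_injective_iff.2 dyckStep_injective (map_dyckStep_boolWord _)

theorem semilength_dyckOfLinearExtension (he : e ∈ linearExtensions (Fin n × Bool) (2 * n)) :
    (dyckOfLinearExtension he).semilength = n := by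
  have hlen := length_boolWord (dyckOfLinearExtension he)
  rw [boolWord_dyckOfLinearExtension, rowWord, List.length_ofFn] at hlen
  omega

theorem dyckOfLinearExtension_injective {e' : Fin (2 * n) ≃ Fin n × Bool}
    {he : e ∈ linearExtensions (Fin n × Bool) (2 * n)}
    {he' : e' ∈ linearExtensions (Fin n × Bool) (2 * n)}
    (h : dyckOfLinearExtension he = dyckOfLinearExtension he') : e = e' := by
  have hrow := congrArg boolWord h
  rw [boolWord_dyckOfLinearExtension, boolWord_dyckOfLinearExtension, rowWord, rowWord,
    List.ofFn_inj] at hrow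
  have hcomm : e.trans (Equiv.prodComm _ _) = e'.trans (Equiv.prodComm _ _) :=
    equiv_prod_eq_of_strictMono (congrFun hrow) (mem_linearExtensions_prod_bool.1 he).1
      (mem_linearExtensions_prod_bool.1 he').1
  simpa [Equiv.ext_iff] using hcomm

theorem exists_linearExtension_rowWord_eq_boolWord {p : DyckWord} (hp : p.semilength = n) :
    ∃ e ∈ linearExtensions (Fin n × Bool) (2 * n), rowWord e = boolWord p := by
  obtain ⟨w, hw⟩ := exists_ofFn_eq ((length_boolWord p).trans (congrArg (2 * ·) hp))
  have hcount (b : Bool) : Finset.card {k | w k = b} = Fintype.card (Fin n) := by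
    have htake := count_take_ofFn w b (2 * n)
    rw [List.take_of_length_le (by simp), hw, count_boolWord, hp] at htake
    simpa using htake.symm
  obtain ⟨e, hfst, hmono⟩ := exists_equiv_prod_of_card_fiber hcount
  have hrow : rowWord (e.trans (Equiv.prodComm _ _)) = boolWord p := by
    rw [← hw, rowWord]
    exact congrArg List.ofFn (funext hfst)
  refine ⟨_, mem_linearExtensions_iff_count_take_le.2 ⟨hmono, ?_⟩, hrow⟩
  rw [hrow]
  exact count_true_take_boolWord_le p

theorem sum_X_pow_des_rowLabel (n : ℕ) :
    ∑ e ∈ linearExtensions (Fin n × Bool) (2 * n), (X : ℚ[X]) ^ des (rowLabel ∘ e) =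
      treePoly n := by
  refine Finset.sum_bij (fun e he => (dyckOfLinearExtension he).toTree) ?_ ?_ ?_ ?_
  · intro e he
    rw [BinaryTree.mem_treesOfNumNodesEq, DyckWord.numNodes_toTree,
      semilength_dyckOfLinearExtension]
  · intro e he e' he' h
    exact dyckOfLinearExtension_injective (DyckWord.equivTree.injective h)
  · intro T hT
    rw [BinaryTree.mem_treesOfNumNodesEq, ← semilength_ofTree] at hT
    obtain ⟨e, he, hrow⟩ := exists_linearExtension_rowWord_eq_boolWord hT
    have hdyck : dyckOfLinearExtension he = DyckWord.ofTree T := by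
      rw [DyckWord.ext_iff, ← map_dyckStep_boolWord, boolWord_dyckOfLinearExtension, hrow,
        map_dyckStep_boolWord]
    exact ⟨e, he, by rw [hdyck, DyckWord.toTree_ofTree]⟩
  · intro e he
    rw [des_rowLabel_comp he, des_eq_listDes, ← rowWord, ← boolWord_dyckOfLinearExtension he,
      ← listDes_boolWord_ofTree, DyckWord.ofTree_toTree]

end RowWords

section TreeLists

variable {α : Type*} [LinearOrder α]

/-- Avoidance of the pattern `132` by a word given as a list. -/
def ListAvoids132 (l : List α) : Prop :=
  l.Triplewise fun a b c => a < c → ¬ c < b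

theorem listAvoids132_ofFn_iff {m : ℕ} {w : Fin m → α} :
    ListAvoids132 (List.ofFn w) ↔ Avoids w perm132 := by
  simp only [ListAvoids132, List.triplewise_iff_getElem, List.getElem_ofFn, List.length_ofFn,
    Avoids, contains_perm132_iff]
  constructor
  · rintro h ⟨i, j, k, hij, hjk, hik, hkj⟩
    exact h i j k hij hjk k.isLt hik hkj
  · exact fun h i j k hij hjk hk hik hkj => h ⟨⟨i, _⟩, ⟨j, _⟩, ⟨k, hk⟩, hij, hjk, hik, hkj⟩

theorem listAvoids132_append_cons_iff {L R : List α} {M : α} (hL : ∀ x ∈ L, x < M)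
    (hR : ∀ y ∈ R, y < M) :
    ListAvoids132 (L ++ M :: R) ↔
      ListAvoids132 L ∧ ListAvoids132 R ∧ ∀ x ∈ L, ∀ y ∈ R, ¬ x < y := by
  simp only [ListAvoids132, List.triplewise_append, List.triplewise_cons, List.pairwise_cons]
  constructor
  · rintro ⟨hLL, ⟨-, hRR⟩, hLR, -⟩
    exact ⟨hLL, hRR, fun x hx y hy hxy => (hLR x hx).1 y hy hxy (hR y hy)⟩
  · rintro ⟨hLL, hRR, hLR⟩
    refine ⟨hLL, ⟨?_, hRR⟩, fun x hx => ⟨fun y hy hxy => absurd hxy (hLR x hx y hy), ?_⟩, ?_⟩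
    · exact List.pairwise_of_forall_mem_list fun b _ c hc hMc => absurd hMc (hR c hc).not_gt
    · exact List.pairwise_of_forall_mem_list fun b _ c hc hxc => absurd hxc (hLR x hx c hc)
    · refine fun c hc => List.pairwise_of_forall_mem_list fun a ha b hb hac => ?_
      rcases List.mem_cons.1 hc with rfl | hc
      exacts [(hL b hb).not_gt, absurd hac (hLR a ha c hc)]

/-- The `132`-avoiding arrangement of `o, o + 1, …` whose largest entry separates the arrangements
of the two subtrees, the entries of the left one being larger. -/
def treeList : BinaryTree Unit → ℕ → List ℕ
  | .nil, _ => []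
  | .node _ l r, o =>
    treeList l (o + r.numNodes) ++ (o + (r.numNodes + l.numNodes)) :: treeList r o

theorem append_cons_perm_range'_iff {L R : List ℕ} {o n : ℕ} :
    (L ++ (o + n) :: R).Perm (List.range' o (n + 1)) ↔ (R ++ L).Perm (List.range' o n) := by
  rw [List.perm_middle.congr_left, List.range'_1_concat,
    (List.perm_append_singleton _ _).congr_right, List.perm_cons, List.perm_append_comm.congr_left]

theorem treeList_perm_range' (T : BinaryTree Unit) (o : ℕ) :
    (treeList T o).Perm (List.range' o T.numNodes) := by
  induction T generalizing o with
  | nil => rfl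
  | node a l r ihl ihr =>
    rw [treeList, BinaryTree.numNodes, add_comm l.numNodes, append_cons_perm_range'_iff,
      ← List.range'_append_1]
    exact (ihr o).append (ihl _)

theorem mem_treeList {T : BinaryTree Unit} {o x : ℕ} :
    x ∈ treeList T o ↔ o ≤ x ∧ x < o + T.numNodes := by
  rw [(treeList_perm_range' T o).mem_iff, List.mem_range'_1]

theorem length_treeList (T : BinaryTree Unit) (o : ℕ) : (treeList T o).length = T.numNodes := by
  rw [(treeList_perm_range' T o).length_eq, List.length_range']

theorem listDes_treeList (T : BinaryTree Unit) (o : ℕ) :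
    listDes (treeList T o) = rightCount T := by
  induction T generalizing o with
  | nil => rfl
  | node a l r ihl ihr =>
    rw [treeList, listDes_append_cons, listDes_cons_of_head_lt, ihl, ihr, length_treeList,
      rightCount, add_assoc]
    · intro x hx
      have := mem_treeList.1 (List.mem_of_mem_head? hx)
      omega
    · intro x hx
      have := mem_treeList.1 hx
      omega

theorem listAvoids132_treeList (T : BinaryTree Unit) (o : ℕ) : ListAvoids132 (treeList T o) := by
  induction T generalizing o with
  | nil => exact .nil
  | node a l r ihl ihr =>
    rw [treeList, listAvoids132_append_cons_iff]
    · refine ⟨ihl _, ihr _, ?_⟩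
      simp only [mem_treeList]
      omega
    all_goals
      simp only [mem_treeList]
      omega

theorem treeList_injective (o : ℕ) : Function.Injective (treeList · o) := by
  intro T T' (h : treeList T o = treeList T' o)
  induction T generalizing o T' with
  | nil =>
    rcases T' with _ | ⟨a, l, r⟩
    · rfl
    · simp [treeList] at h
  | node a l r ihl ihr =>
    rcases T' with _ | ⟨a', l', r'⟩
    · simp [treeList] at h
    · have hnum := congrArg List.length h
      simp only [length_treeList, BinaryTree.numNodes] at hnum
      rw [treeList, treeList, show r.numNodes + l.numNodes = r'.numNodes + l'.numNodes by omega,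
        List.append_cons_inj_of_notMem (by rw [mem_treeList]; omega)
          (by rw [mem_treeList]; omega)] at h
      obtain ⟨hl, -, hr⟩ := h
      obtain rfl := ihr o hr
      obtain rfl := ihl _ hl
      rfl

/-- Sorting both parts sorts the whole list. -/
theorem perm_range'_of_append_perm_range' {L R : List ℕ} {o n : ℕ}
    (h : (R ++ L).Perm (List.range' o n)) (hle : ∀ y ∈ R, ∀ x ∈ L, y ≤ x) :
    R.Perm (List.range' o R.length) ∧ L.Perm (List.range' (o + R.length) L.length) := by
  let sort (l : List ℕ) := l.mergeSort (· ≤ ·)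
  have sort_perm (l : List ℕ) : (sort l).Perm l := List.mergeSort_perm l _
  have hsorted : (sort R ++ sort L).SortedLE := by
    refine List.Pairwise.sortedLE (List.pairwise_append.2
      ⟨List.sortedLE_mergeSort.pairwise, List.sortedLE_mergeSort.pairwise, fun y hy x hx => ?_⟩)
    exact hle y ((sort_perm R).mem_iff.1 hy) x ((sort_perm L).mem_iff.1 hx)
  have heq : List.range' o n = sort R ++ sort L :=
    (List.Perm.eq_of_sortedLE hsorted (List.pairwise_le_range' 1).sortedLE
      (((sort_perm R).append (sort_perm L)).trans h)).symm
  obtain ⟨k, -, hR, hL⟩ := List.range'_eq_append_iff.1 heq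
  have hRperm := hR ▸ (sort_perm R).symm
  have hLperm := hL ▸ (sort_perm L).symm
  obtain rfl : R.length = k := by rw [hRperm.length_eq, List.length_range']
  have hlen : L.length = n - R.length := by rw [hLperm.length_eq, List.length_range']
  rw [mul_one, ← hlen] at hLperm
  exact ⟨hRperm, hLperm⟩

theorem exists_treeList_eq {l : List ℕ} {o n : ℕ} (hl : l.Perm (List.range' o n))
    (havoid : ListAvoids132 l) : ∃ T : BinaryTree Unit, T.numNodes = n ∧ treeList T o = l := by
  induction n using Nat.strong_induction_on generalizing l o with
  | _ n ih =>
    rcases n with _ | n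
    · exact ⟨.nil, rfl, hl.eq_nil.symm⟩
    · obtain ⟨L, R, rfl⟩ := List.append_of_mem (hl.mem_iff.2 (List.mem_range'_1.2
        ⟨Nat.le_add_right o n, Nat.lt_succ_self _⟩))
      rw [append_cons_perm_range'_iff] at hl
      have hlt (x : ℕ) (hx : x ∈ R ++ L) : x < o + n := (List.mem_range'_1.1 (hl.mem_iff.1 hx)).2
      obtain ⟨hLavoid, hRavoid, hLR⟩ := (listAvoids132_append_cons_iff
        (fun x hx => hlt x (List.mem_append_right R hx))
        (fun y hy => hlt y (List.mem_append_left L hy))).1 havoid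
      obtain ⟨hR, hL⟩ := perm_range'_of_append_perm_range' hl
        fun y hy x hx => not_lt.1 (hLR x hx y hy)
      have hlen : R.length + L.length = n := by
        rw [← List.length_append, hl.length_eq, List.length_range']
      obtain ⟨TR, hTR, rfl⟩ := ih R.length (by omega) hR hRavoid
      obtain ⟨TL, hTL, rfl⟩ := ih L.length (by omega) hL hLavoid
      rw [length_treeList, length_treeList] at hlen
      exact ⟨.node () TL TR, by rw [BinaryTree.numNodes, add_comm TL.numNodes, hlen],
        by rw [treeList, hlen, hTR]⟩

theorem exists_treeList_eq_iff {l : List ℕ} {o n : ℕ} :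
    (∃ T : BinaryTree Unit, T.numNodes = n ∧ treeList T o = l) ↔
      l.Perm (List.range' o n) ∧ ListAvoids132 l := by
  refine ⟨?_, fun h => exists_treeList_eq h.1 h.2⟩
  rintro ⟨T, rfl, rfl⟩
  exact ⟨treeList_perm_range' T o, listAvoids132_treeList T o⟩

theorem exists_perm_ofFn_eq_iff {n : ℕ} {l : List ℕ} :
    (∃ τ : Equiv.Perm (Fin n), List.ofFn (Fin.val ∘ τ) = l) ↔ l.Perm (List.range' 0 n) := by
  rw [← List.range_eq_range']
  constructor
  · rintro ⟨τ, rfl⟩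
    exact (τ.ofFn_comp_perm Fin.val).trans (by simp [List.ofFn_eq_map])
  · intro h
    obtain ⟨w, rfl⟩ := exists_ofFn_eq (h.length_eq.trans List.length_range)
    have hlt (i : Fin n) : w i < n := List.mem_range.1 (h.mem_iff.1 (List.mem_ofFn.2 ⟨i, rfl⟩))
    have hw : Function.Injective w := List.nodup_ofFn.1 (h.nodup_iff.2 List.nodup_range)
    exact ⟨Equiv.ofBijective (fun i => ⟨w i, hlt i⟩) (Finite.injective_iff_bijective.1
      fun i j hij => hw (congrArg Fin.val hij)), rfl⟩

end TreeLists

section PermAvoiding132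

theorem mem_permAvoiding {n k : ℕ} {S : Set (Equiv.Perm (Fin k))} {τ : Equiv.Perm (Fin n)} :
    τ ∈ permAvoiding n S ↔ ∀ σ ∈ S, Avoids τ σ := by
  simp [permAvoiding]

theorem image_ofFn_permAvoiding_132 (n : ℕ) :
    (permAvoiding n {perm132}).image (fun τ : Equiv.Perm (Fin n) => List.ofFn (Fin.val ∘ τ)) =
      (BinaryTree.treesOfNumNodesEq n).image (treeList · 0) := by
  ext l
  simp only [Finset.mem_image, mem_permAvoiding, Set.mem_singleton_iff, forall_eq,
    BinaryTree.mem_treesOfNumNodesEq, exists_treeList_eq_iff, ← exists_perm_ofFn_eq_iff,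
    ← avoids_comp_iff Fin.val_strictMono, ← listAvoids132_ofFn_iff]
  constructor
  · rintro ⟨τ, havoid, rfl⟩
    exact ⟨⟨τ, rfl⟩, havoid⟩
  · rintro ⟨⟨τ, rfl⟩, havoid⟩
    exact ⟨τ, havoid, rfl⟩

theorem sum_permAvoiding_132 (n : ℕ) :
    ∑ τ ∈ permAvoiding n {perm132}, (X : ℚ[X]) ^ des τ = treePoly n := by
  have hinj : Function.Injective fun τ : Equiv.Perm (Fin n) => List.ofFn (Fin.val ∘ τ) :=
    List.ofFn_injective.comp (Fin.val_injective.comp_left.comp DFunLike.coe_injective)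
  calc ∑ τ ∈ permAvoiding n {perm132}, (X : ℚ[X]) ^ des τ
    _ = ∑ τ ∈ permAvoiding n {perm132}, X ^ listDes (List.ofFn (Fin.val ∘ τ)) := by
      simp only [← des_eq_listDes, des_comp_strictMono Fin.val_strictMono]
    _ = ∑ T ∈ BinaryTree.treesOfNumNodesEq n, X ^ listDes (treeList T 0) := by
      rw [← Finset.sum_image (f := fun l => (X : ℚ[X]) ^ listDes l) hinj.injOn,
        image_ofFn_permAvoiding_132, Finset.sum_image (treeList_injective 0).injOn]
    _ = treePoly n := by simp only [listDes_treeList, treePoly]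

end PermAvoiding132

section ShuffleWords

variable {n : ℕ} {τ τ' : Equiv.Perm (Fin n)} {e e' : Fin (2 * n) ≃ Fin n × Bool}

/-- The shuffle of two copies of `τ` whose `k`-th letter is taken from the position and the copy
given by `e k`. -/
def shuffleWord (τ : Equiv.Perm (Fin n)) (e : Fin (2 * n) ≃ Fin n × Bool) :
    Fin (2 * n) → Fin n := fun k => τ (e k).1

theorem shuffleWord_symm (τ : Equiv.Perm (Fin n)) (e : Fin (2 * n) ≃ Fin n × Bool) (i : Fin n)
    (b : Bool) : shuffleWord τ e (e.symm (i, b)) = τ i := by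
  rw [shuffleWord, e.apply_symm_apply]

theorem eq_symm_of_shuffleWord_eq (he : e ∈ linearExtensions (Fin n × Bool) (2 * n))
    {p q : Fin (2 * n)} (hpq : p < q) (h : shuffleWord τ e p = shuffleWord τ e q) :
    ∃ i, p = e.symm (i, false) ∧ q = e.symm (i, true) := by
  obtain ⟨⟨i, a⟩, rfl⟩ := e.symm.surjective p
  obtain ⟨⟨j, b⟩, rfl⟩ := e.symm.surjective q
  rw [shuffleWord_symm, shuffleWord_symm] at h
  obtain rfl := τ.injective h
  have hcopies := (mem_linearExtensions_prod_bool.1 he).2 i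
  rcases a with _ | _ <;> rcases b with _ | _
  · exact absurd hpq (lt_irrefl _)
  · exact ⟨i, rfl, rfl⟩
  · exact absurd hpq hcopies.not_gt
  · exact absurd hpq (lt_irrefl _)

theorem isDoublePerm_shuffleWord (τ : Equiv.Perm (Fin n)) (e : Fin (2 * n) ≃ Fin n × Bool) :
    IsDoublePerm (shuffleWord τ e) := by
  intro l
  have hfiber : ({k | shuffleWord τ e k = l} : Finset (Fin (2 * n))) =
      (({τ.symm l} : Finset (Fin n)) ×ˢ Finset.univ).map e.symm.toEmbedding := by
    ext k
    rw [Finset.mem_filter_univ, Finset.mem_map_equiv, Finset.mem_product, Finset.mem_singleton,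
      Equiv.eq_symm_apply, Equiv.symm_symm, shuffleWord, and_iff_left (Finset.mem_univ _)]
  rw [hfiber, Finset.card_map, Finset.card_product, Finset.card_singleton, Finset.card_univ,
    Fintype.card_bool, one_mul]

theorem isNonnesting_shuffleWord (he : e ∈ linearExtensions (Fin n × Bool) (2 * n)) :
    IsNonnesting (shuffleWord τ e) := by
  refine ⟨isDoublePerm_shuffleWord τ e, avoids_1221_and_2112_iff.2 ?_⟩
  intro p q r s hpq hqr hrs hps hqr'
  obtain ⟨i, rfl, rfl⟩ := eq_symm_of_shuffleWord_eq he (hpq.trans (hqr.trans hrs)) hps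
  obtain ⟨j, rfl, rfl⟩ := eq_symm_of_shuffleWord_eq he hqr hqr'
  have hrow := (mem_linearExtensions_prod_bool.1 he).1
  exact absurd ((hrow false).lt_iff_lt.1 hpq) ((hrow true).lt_iff_lt.1 hrs).not_gt

theorem exists_shuffleWord_eq {π : Fin (2 * n) → Fin n} (hπ : IsNonnesting π) :
    ∃ τ, ∃ e ∈ linearExtensions (Fin n × Bool) (2 * n), shuffleWord τ e = π := by
  obtain ⟨hdouble, havoid⟩ := hπ
  obtain ⟨e, hfst, hcopies⟩ := exists_equiv_prod_of_card_fiber (κ := Bool) hdouble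
  have hletter (l : Fin n) (b : Bool) : π (e.symm (l, b)) = l := by
    rw [← hfst, e.apply_symm_apply]
  have hcopies (l : Fin n) : e.symm (l, false) < e.symm (l, true) := hcopies l Bool.false_lt_true
  have hsecond {l l' : Fin n} (h : e.symm (l, false) < e.symm (l', false)) :
      e.symm (l, true) < e.symm (l', true) := by
    by_contra hle
    have hne : l ≠ l' := by
      rintro rfl
      exact lt_irrefl _ h
    have hlt : e.symm (l', true) < e.symm (l, true) :=
      lt_of_le_of_ne (not_lt.1 hle) (e.symm.injective.ne (by simp [hne.symm]))
    have := avoids_1221_and_2112_iff.1 havoid _ _ _ _ h (hcopies l') hlt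
    simp only [hletter, true_imp_iff] at this
    exact hne this
  obtain ⟨τ, hτ⟩ := exists_equiv_strictMono_comp (Fintype.card_fin n)
    (key := fun l => e.symm (l, false)) fun l l' h => congrArg Prod.fst (e.symm.injective h)
  refine ⟨τ, e.trans (τ.symm.prodCongr (Equiv.refl Bool)),
    mem_linearExtensions_prod_bool.2 ⟨?_, fun i => hcopies (τ i)⟩, ?_⟩
  · rintro (_ | _)
    exacts [hτ, fun i j hij => hsecond (hτ hij)]
  · ext k : 1
    simp [shuffleWord, hfst]

theorem shuffleWord_injective (he : e ∈ linearExtensions (Fin n × Bool) (2 * n))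
    (he' : e' ∈ linearExtensions (Fin n × Bool) (2 * n))
    (h : shuffleWord τ e = shuffleWord τ' e') : τ = τ' ∧ e = e' := by
  obtain ⟨hrow, hcopies⟩ := mem_linearExtensions_prod_bool.1 he
  obtain ⟨hrow', hcopies'⟩ := mem_linearExtensions_prod_bool.1 he'
  have strictMono_bool {f : Bool → Fin (2 * n)} (hf : f false < f true) : StrictMono f := by
    rintro (_ | _) (_ | _) hab
    exacts [absurd hab (by decide), hf, absurd hab (by decide), absurd hab (by decide)]
  have hletters : e.trans (τ.prodCongr (Equiv.refl Bool)) =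
      e'.trans (τ'.prodCongr (Equiv.refl Bool)) :=
    equiv_prod_eq_of_strictMono (congrFun h) (fun l => strictMono_bool (hcopies (τ.symm l)))
      fun l => strictMono_bool (hcopies' (τ'.symm l))
  have hpos (l : Fin n) : e.symm (τ.symm l, false) = e'.symm (τ'.symm l, false) :=
    congrArg (fun d => d.symm (l, false)) hletters
  obtain rfl : τ = τ' := by
    refine equiv_eq_of_strictMono_comp (key := fun l => e.symm (τ.symm l, false))
      (fun l l' hl => by simpa using hl) ?_ ?_
    · simpa [Function.comp_def] using hrow false
    · simpa [Function.comp_def, hpos] using hrow' false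
  exact ⟨rfl, Equiv.ext fun k =>
    (τ.prodCongr (Equiv.refl Bool)).injective (Equiv.congr_fun hletters k)⟩

theorem contains_doubleMiddle_iff (he : e ∈ linearExtensions (Fin n × Bool) (2 * n))
    (σ : Equiv.Perm (Fin 3)) : Contains (shuffleWord τ e) (doubleMiddle σ) ↔ Contains τ σ := by
  obtain ⟨hrow, hcopies⟩ := mem_linearExtensions_prod_bool.1 he
  have hmono := (mem_linearExtensions.1 he).monotone
  rw [contains_iff, contains_iff, doubleMiddle_eq_comp]
  constructor
  · rintro ⟨f, hf, hord⟩
    obtain ⟨j, hj₁, hj₂⟩ := eq_symm_of_shuffleWord_eq he (hf (by decide : (1 : Fin 4) < 2))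
      ((hord 1 2).2.2 rfl)
    have hfst : (e (f 0)).1 < j := by
      by_contra! hle
      refine (hf (by decide : (0 : Fin 4) < 1)).not_ge ?_
      rw [hj₁, ← e.symm_apply_apply (f 0)]
      exact hmono ⟨hle, Bool.false_le _⟩
    have hsnd : j < (e (f 3)).1 := by
      by_contra! hle
      refine (hf (by decide : (2 : Fin 4) < 3)).not_ge ?_
      rw [hj₂, ← e.symm_apply_apply (f 3)]
      exact hmono ⟨hle, Bool.le_true _⟩
    refine ⟨![(e (f 0)).1, j, (e (f 3)).1], by simp [hfst, hsnd], ?_⟩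
    convert hord.comp ![0, 1, 3] using 1
    · ext r : 1
      fin_cases r <;> simp [shuffleWord, hj₁]
    · ext r : 1
      fin_cases r <;> rfl
  · rintro ⟨g, hg, hord⟩
    refine ⟨![e.symm (g 0, false), e.symm (g 1, false), e.symm (g 1, true), e.symm (g 2, true)],
      by simp [hcopies, hrow false (hg (by decide : (0 : Fin 3) < 1)),
        hrow true (hg (by decide : (1 : Fin 3) < 2))], ?_⟩
    convert hord.comp ![0, 1, 1, 2] using 1
    ext r : 1
    fin_cases r <;> exact shuffleWord_symm _ _ _ _

end ShuffleWords

section NonnestingPermutations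

variable {n : ℕ}

theorem mem_nonnestingAvoiding {β : Type*} [LinearOrder β] {k : ℕ} {Λ : Set (Fin k → β)}
    {π : Fin (2 * n) → Fin n} :
    π ∈ nonnestingAvoiding n Λ ↔ IsNonnesting π ∧ ∀ p ∈ Λ, Avoids π p := by
  simp [nonnestingAvoiding]

theorem shuffleWord_mem_nonnestingAvoiding_iff {τ : Equiv.Perm (Fin n)}
    {e : Fin (2 * n) ≃ Fin n × Bool} (he : e ∈ linearExtensions (Fin n × Bool) (2 * n))
    {S : Set (Equiv.Perm (Fin 3))} :
    shuffleWord τ e ∈ nonnestingAvoiding n (doubleMiddle '' S) ↔ τ ∈ permAvoiding n S := by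
  rw [mem_nonnestingAvoiding, mem_permAvoiding, and_iff_right (isNonnesting_shuffleWord he),
    Set.forall_mem_image]
  simp only [Avoids, contains_doubleMiddle_iff he]

theorem sum_nonnestingAvoiding {M : Type*} [AddCommMonoid M] (S : Set (Equiv.Perm (Fin 3)))
    (f : (Fin (2 * n) → Fin n) → M) :
    ∑ π ∈ nonnestingAvoiding n (doubleMiddle '' S), f π =
      ∑ τ ∈ permAvoiding n S, ∑ e ∈ linearExtensions (Fin n × Bool) (2 * n),
        f (shuffleWord τ e) := by
  rw [← Finset.sum_product']
  symm
  refine Finset.sum_bij (fun p _ => shuffleWord p.1 p.2) ?_ ?_ ?_ fun _ _ => rfl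
  · rintro ⟨τ, e⟩ h
    obtain ⟨hτ, he⟩ := Finset.mem_product.1 h
    exact (shuffleWord_mem_nonnestingAvoiding_iff he).2 hτ
  · rintro ⟨τ, e⟩ h ⟨τ', e'⟩ h' heq
    obtain ⟨rfl, rfl⟩ := shuffleWord_injective (Finset.mem_product.1 h).2
      (Finset.mem_product.1 h').2 heq
    rfl
  · intro π hπ
    obtain ⟨τ, e, he, rfl⟩ := exists_shuffleWord_eq (mem_nonnestingAvoiding.1 hπ).1
    exact ⟨(τ, e), Finset.mem_product.2
      ⟨(shuffleWord_mem_nonnestingAvoiding_iff he).1 hπ, he⟩, rfl⟩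

theorem sum_X_pow_des_shuffleWord (hn : 1 ≤ n) (τ : Equiv.Perm (Fin n)) :
    ∑ e ∈ linearExtensions (Fin n × Bool) (2 * n), (X : ℚ[X]) ^ des (shuffleWord τ e) =
      narayana n * X ^ des τ := by
  calc ∑ e ∈ linearExtensions (Fin n × Bool) (2 * n), (X : ℚ[X]) ^ des (shuffleWord τ e)
    _ = ∑ e ∈ linearExtensions (Fin n × Bool) (2 * n), X ^ des (doubleLabel τ ∘ e) :=
      Finset.sum_congr rfl fun _ he => congrArg _ (des_doubleLabel_comp he τ.injective).symm
    _ = narayana n * X ^ des τ := by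
      rw [sum_X_pow_des_doubleLabel ℚ hn τ.injective, sum_X_pow_des_rowLabel,
        treePoly_eq_narayana hn, mul_comm]

theorem sum_nonnestingAvoiding_doubleMiddle (hn : 1 ≤ n) (S : Set (Equiv.Perm (Fin 3))) :
    ∑ π ∈ nonnestingAvoiding n (doubleMiddle '' S), (X : ℚ[X]) ^ des π =
      narayana n * ∑ τ ∈ permAvoiding n S, (X : ℚ[X]) ^ des τ := by
  simp only [sum_nonnestingAvoiding, sum_X_pow_des_shuffleWord hn, Finset.mul_sum]

theorem nonnestingAvoiding_1332 (n : ℕ) :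
    nonnestingAvoiding n ({![1, 3, 3, 2]} : Set (Fin 4 → ℕ)) =
      nonnestingAvoiding n (doubleMiddle '' {perm132}) := by
  ext π
  simp only [mem_nonnestingAvoiding, Set.image_singleton, Set.mem_singleton_iff, forall_eq,
    avoids_congr_right sameRelativeOrder_1332_doubleMiddle_perm132]

end NonnestingPermutations

end NonnestingPerm

theorem mainTheorem10 (n : ℕ) (hn : 1 ≤ n) :
    (∀ S : Set (Equiv.Perm (Fin 3)),
      ∑ π ∈ NonnestingPerm.nonnestingAvoiding n (NonnestingPerm.doubleMiddle '' S),
          (X : ℚ[X]) ^ NonnestingPerm.des π =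
        NonnestingPerm.narayana n *
          ∑ τ ∈ NonnestingPerm.permAvoiding n S,
            (X : ℚ[X]) ^ NonnestingPerm.des (τ : Fin n → Fin n)) ∧
    ∑ π ∈ NonnestingPerm.nonnestingAvoiding n ({![1, 3, 3, 2]} : Set (Fin 4 → ℕ)),
        (X : ℚ[X]) ^ NonnestingPerm.des π =
      NonnestingPerm.narayana n ^ 2 := by
  refine ⟨NonnestingPerm.sum_nonnestingAvoiding_doubleMiddle hn, ?_⟩
  rw [NonnestingPerm.nonnestingAvoiding_1332, NonnestingPerm.sum_nonnestingAvoiding_doubleMiddle hn,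
    NonnestingPerm.sum_permAvoiding_132, NonnestingPerm.treePoly_eq_narayana hn, sq]
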